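/- In the {Downward-Closed Secretary} problem an adversary fixes $n$ items with values $y_i\ge 0$ and a nonempty downward-closed family $\mathcal F$ of feasible subsets of the items. The items arrive in a uniformly random order. The algorithm is given $n$ in advance, but neither $\mathcal F$ nor the values $y_i$. When an item arrives, the algorithm learns its value and which sets consisting of it and previously arrived items are feasible, and must decide immediately and irrevocably whether to add it to the set $W$ of selected items (initially $W=\emptyset$), which must always remain in $\mathcal F$. Let $r$ be the maximum cardinality of a set in $\mathcal F$. There are an absolute constant $C>0$ and a randomized algorithm for this problem which has competitive ratio $O(\log n\cdot\log r)$ in the following sense: for every $n$, every $\mathcal F$ and all values $y_i\ge 0$, the set $W$ finally selected satisfies $$\mathbb E\Big[\sum_{i\in W}y_i\Big]\;\ge\;\frac{1}{C\cdot\max\{1,\log_2 n\}\cdot\max\{1,\log_2 r\}}\;\max_{S\in\mathcal F}\sum_{i\in S}y_i ,$$ where the expectation is over the arrival order and the independent internal randomness of the algorithm, and $\max\{1,\log_2 0\}$ is read as $1$. (For $n,r\ge 2$ the denominator is just $C\log_2 n\log_2 r$.) -/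

import Mathlib

/-- An instance of the downward-closed secretary problem on the items `Fin n`: a nonempty
downward-closed family of feasible sets, and nonnegative item values. -/
structure SecretaryInstance (n : ℕ) where
  feasible : Finset (Finset (Fin n))
  nonempty : feasible.Nonempty
  downwardClosed : ∀ S ∈ feasible, ∀ T ⊆ S, T ∈ feasible
  value : Fin n → ℝ
  value_nonneg : ∀ i, 0 ≤ value i

namespace SecretaryInstance

variable {n : ℕ}

/-- The offline optimum `max_{S ∈ F} ∑_{i ∈ S} y i`. -/
noncomputable def opt (I : SecretaryInstance n) : ℝ :=
  I.feasible.sup' I.nonempty (fun S => ∑ i ∈ S, I.value i)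

/-- The maximum cardinality `r` of a feasible set. -/
def rank (I : SecretaryInstance n) : ℕ :=
  I.feasible.sup Finset.card

end SecretaryInstance

/-- What an online algorithm knows when it has to decide about the item arriving at time `time`.
Items are referred to only by their arrival times. The field `value` gives the values of the items
that arrived at times `j ≤ time` (and is set to `0` for the later times, about which nothing is
revealed); `feasible` lists the feasible sets all of whose items arrived at times `j ≤ time`;
`selected` is the set of (arrival times of) items selected before. -/
structure SecretaryView (n : ℕ) where
  time : Fin n
  value : Fin n → ℝ
  feasible : Finset (Finset (Fin n))
  selected : Finset (Fin n)

/-- The view at time `t`, when the item arriving at time `j` is `σ j` and the items that arrived at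
the times in `W` have been selected before. -/
noncomputable def SecretaryInstance.view {n : ℕ} (I : SecretaryInstance n)
    (σ : Equiv.Perm (Fin n)) (t : Fin n) (W : Finset (Fin n)) : SecretaryView n where
  time := t
  value := fun j => if j ≤ t then I.value (σ j) else 0
  feasible := Finset.univ.filter
    (fun S : Finset (Fin n) => (∀ j ∈ S, j ≤ t) ∧ S.image σ ∈ I.feasible)
  selected := W

/-- A randomized online algorithm for `n` items: a random seed with finitely many outcomes is drawn
at the beginning, and then each accept/reject decision is a function of the seed and the current
view. -/
structure RandomizedSecretaryAlgorithm (n : ℕ) where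
  Seed : Type
  [fintypeSeed : Fintype Seed]
  prob : Seed → ℝ
  prob_nonneg : ∀ s, 0 ≤ prob s
  prob_sum : ∑ s, prob s = 1
  accept : Seed → SecretaryView n → Bool

namespace RandomizedSecretaryAlgorithm

variable {n : ℕ}

attribute [instance] RandomizedSecretaryAlgorithm.fintypeSeed

/-- The arrival times of the items selected among the first `k` arrivals, for the seed `s` and the
arrival order `σ`. -/
noncomputable def selectedTimes (A : RandomizedSecretaryAlgorithm n) (I : SecretaryInstance n)
    (s : A.Seed) (σ : Equiv.Perm (Fin n)) : ℕ → Finset (Fin n)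
  | 0 => ∅
  | k + 1 =>
    let W := selectedTimes A I s σ k
    if h : k < n then
      if A.accept s (I.view σ ⟨k, h⟩ W) = true then insert ⟨k, h⟩ W else W
    else W

/-- The set `W` of items selected among the first `k` arrivals. -/
noncomputable def selectedItems (A : RandomizedSecretaryAlgorithm n) (I : SecretaryInstance n)
    (s : A.Seed) (σ : Equiv.Perm (Fin n)) (k : ℕ) : Finset (Fin n) :=
  (A.selectedTimes I s σ k).image σ

/-- At all times the set of selected items is feasible, on every instance, for every arrival order
and every outcome of the seed. -/
def MaintainsFeasibility (A : RandomizedSecretaryAlgorithm n) : Prop :=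
  ∀ (I : SecretaryInstance n) (s : A.Seed) (σ : Equiv.Perm (Fin n)) (k : ℕ),
    A.selectedItems I s σ k ∈ I.feasible

/-- The expected total value of the selected items, over the random seed and an independent
uniformly random arrival order. -/
noncomputable def expectedValue (A : RandomizedSecretaryAlgorithm n)
    (I : SecretaryInstance n) : ℝ :=
  ∑ s, A.prob s *
    ((∑ σ : Equiv.Perm (Fin n), ∑ i ∈ A.selectedItems I s σ n, I.value i) / (n.factorial : ℝ))

/-- `A` is a valid algorithm whose expected value is, on every instance `I`, at least the offline
optimum divided by `ρ I`. -/
def AchievesCompetitiveRatio (A : RandomizedSecretaryAlgorithm n)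
    (ρ : SecretaryInstance n → ℝ) : Prop :=
  A.MaintainsFeasibility ∧ ∀ I : SecretaryInstance n, I.opt / ρ I ≤ A.expectedValue I

end RandomizedSecretaryAlgorithm

/-! The first half of the arrivals is a sample. Let `k * v` be the maximum of size times minimum
value over the feasible sampled sets. In a feasible set the `j`-th largest sampled value is at most
`k * v / j`, so its sampled part is worth at most `k * v` times a harmonic number (`sum_sample_le`);
this is the factor `log r`. It remains to earn about `k * v / log n` in the second half, up to a
multiple of the largest feasible single value `M`, which the two secretary rules supply
(`value_mul_factorial_le`).

The threshold rule keeps to items of value at least `v` and wants `m = quota n k` of them, about `k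
/ (17 log n)`. It is guided by a game on all items seen so far, sampled ones included: with `d`
selections to go, each of `d` moves must leave at least `q = k - m` choices that keep the game
alive. The sampled `k`-set makes the game rich at the start (`Rich.of_union_mem`), and an item is
accepted exactly if the game with one move fewer is still rich afterwards, so richness is never lost
(`rich_picked`).

Suppose the rule stops short, with `P` the set of selection times. Then at every other time of the
second half the arriving item misses the at least `q` good choices. Fix `P` and expose the order
backwards: given the later arrivals and the items at `P`, the item at time `t` is uniform among at
most `n` items, so a miss has probability at most `1 - q / n` (`card_forall_perm_le`). At least `n /
4` such times give `exp (-q / 4)`, which beats the at most `n ^ m` sets `P` and the `n ^ 2` pairs of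
threshold and size. So bad orders have probability at most `1 / n` (`card_badOrders_mul_le`); as `k
* v ≤ n * M` always, they cost at most `M` on average. -/

/-! ### The richness game -/

open Classical in
/-- `Rich F q d A W`: in the game of enlarging `W` by elements of `A` within `F`, at each of the
next `d` moves at least `q` choices keep the game alive. -/
def Rich {α : Type*} [DecidableEq α] (F : Finset (Finset α)) (q : ℕ) : ℕ → Finset α → Finset α → Prop
  | 0, _, W => W ∈ F
  | d + 1, A, W => W ∈ F ∧ q ≤ ((A \ W).filter fun i => Rich F q d A (insert i W)).card

namespace Rich

variable {α β : Type*} [DecidableEq α] [DecidableEq β] {F : Finset (Finset α)} {q d : ℕ} {A B W : Finset α}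

theorem mem (h : Rich F q d A W) : W ∈ F := by
  cases d with
  | zero => exact h
  | succ d => exact h.1

theorem mono (hAB : A ⊆ B) (h : Rich F q d A W) : Rich F q d B W := by
  induction d generalizing W with
  | zero => exact h
  | succ d ih =>
    refine ⟨h.1, h.2.trans (Finset.card_le_card ?_)⟩
    intro i hi
    simp only [Finset.mem_filter, Finset.mem_sdiff] at hi ⊢
    exact ⟨⟨hAB hi.1.1, hi.1.2⟩, ih hi.2⟩

-- Playing only elements of `S` stays inside `S ∪ W`, and before each of the `d` moves more than `q`
-- elements of `S` are unused.
open Classical in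
theorem of_union_mem (hF : ∀ S ∈ F, ∀ T ⊆ S, T ∈ F) {S : Finset α} (hSA : S ⊆ A)
    (hSW : Disjoint S W) (hS : S ∪ W ∈ F) (hq : q + d ≤ S.card) : Rich F q d A W := by
  induction d generalizing W S with
  | zero => exact hF _ hS _ Finset.subset_union_right
  | succ d ih =>
    refine ⟨hF _ hS _ Finset.subset_union_right, ?_⟩
    have hsub : S ⊆ (A \ W).filter fun i => Rich F q d A (insert i W) := by
      intro i hi
      have hiW : i ∉ W := Finset.disjoint_left.1 hSW hi
      rw [Finset.mem_filter, Finset.mem_sdiff]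
      refine ⟨⟨hSA hi, hiW⟩, ?_⟩
      have := ih (W := insert i W) (S := S.erase i) ((Finset.erase_subset _ _).trans hSA) ?_ ?_ ?_
      · exact this
      · rw [Finset.disjoint_insert_right]
        exact ⟨Finset.notMem_erase _ _, hSW.mono_left (Finset.erase_subset _ _)⟩
      · refine hF _ hS _ ?_
        intro x hx
        simp only [Finset.mem_union, Finset.mem_erase, Finset.mem_insert] at hx ⊢
        rcases hx with hx | rfl | hx
        · exact Or.inl hx.2
        · exact Or.inl hi
        · exact Or.inr hx
      · rw [Finset.card_erase_of_mem hi]; omega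
    calc q ≤ S.card := by omega
      _ ≤ _ := Finset.card_le_card hsub

-- The algorithm plays the game on arrival times, the analysis on items; this translates along the
-- arrival order.
open Classical in
theorem image_iff {G : Finset (Finset β)} {e : α → β}
    (he : Function.Injective e) (hG : ∀ S ⊆ A, S ∈ F ↔ S.image e ∈ G) (hW : W ⊆ A) :
    Rich F q d A W ↔ Rich G q d (A.image e) (W.image e) := by
  induction d generalizing W with
  | zero => exact hG W hW
  | succ d ih =>
    refine and_congr (hG W hW) ?_
    have : ((A.image e \ W.image e).filter fun i => Rich G q d (A.image e) (insert i (W.image e)))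
        = ((A \ W).filter fun i => Rich F q d A (insert i W)).image e := by
      rw [← Finset.image_sdiff _ _ he]
      ext b
      simp only [Finset.mem_filter, Finset.mem_image, Finset.mem_sdiff]
      constructor
      · rintro ⟨⟨a, ha, rfl⟩, hb⟩
        refine ⟨a, ⟨ha, ?_⟩, rfl⟩
        rw [ih (Finset.insert_subset ha.1 hW), Finset.image_insert]
        exact hb
      · rintro ⟨a, ⟨ha, hb⟩, rfl⟩
        refine ⟨⟨a, ha, rfl⟩, ?_⟩
        rw [ih (Finset.insert_subset ha.1 hW), Finset.image_insert] at hb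
        exact hb
    rw [this, Finset.card_image_of_injective _ he]

end Rich

/-! ### Reverse exposure and stuck orders -/

open Classical in
/-- Reverse exposure of a random permutation: if the `k`-th event survives only few of the
exchanges of position `k` with an earlier free position, and the later events do not notice these
exchanges, then all events together are unlikely. -/
theorem card_forall_perm_le {n : ℕ} (P T : Finset (Fin n)) (hT : ∀ t ∈ T, t ∉ P) (q : ℕ)
    (hq : q ≤ n) (E : Fin n → Equiv.Perm (Fin n) → Prop)
    (hinv : ∀ s k t : Fin n, s ∉ P → k ∉ P → s ≤ k → k < t → ∀ σ : Equiv.Perm (Fin n),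
      E t (σ * Equiv.swap s k) ↔ E t σ)
    (hcount : ∀ k ∈ T, ∀ σ : Equiv.Perm (Fin n), ∀ R ⊆ Finset.Iic k \ P,
      (∀ s ∈ R, E k (σ * Equiv.swap s k)) → R.card ≤ (Finset.Iic k \ P).card - q) :
    (n : ℝ) ^ T.card * ((Finset.univ.filter fun σ => ∀ t ∈ T, E t σ).card : ℝ)
      ≤ ((n : ℝ) - q) ^ T.card * (n.factorial : ℝ) := by
  induction T using Finset.induction_on_min with
  | empty => simp [Fintype.card_perm]
  -- The earliest time is added last: exchanging `k` with an earlier free position does not disturb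
  -- the events at later times.
  | insert k T hk ih =>
    have hkT : k ∉ T := fun h => lt_irrefl _ (hk k h)
    have hkP : k ∉ P := hT k (Finset.mem_insert_self _ _)
    specialize ih (fun t ht => hT t (Finset.mem_insert_of_mem ht))
      (fun t ht => hcount t (Finset.mem_insert_of_mem ht))
    specialize hcount k (Finset.mem_insert_self _ _)
    set B : Finset (Equiv.Perm (Fin n)) := Finset.univ.filter fun σ => ∀ t ∈ T, E t σ with hB
    set B' : Finset (Equiv.Perm (Fin n)) :=
      Finset.univ.filter fun σ => ∀ t ∈ insert k T, E t σ with hB'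
    set R := Finset.Iic k \ P with hR
    have hkR : k ∈ R := by simp [hR, hkP]
    have hsub : B' ⊆ B := by
      intro σ hσ
      simp only [hB, hB', Finset.mem_filter, Finset.mem_univ, true_and] at hσ ⊢
      exact fun t ht => hσ t (Finset.mem_insert_of_mem ht)
    have hcardB : B'.card ≤ B.card := Finset.card_le_card hsub
    have hs : ∀ s ∈ R, (B.filter fun σ => E k (σ * Equiv.swap s k)).card = B'.card := by
      intro s hs
      have hs' : s ≤ k ∧ s ∉ P := by simpa [hR] using hs
      refine Finset.card_bij (fun σ _ => σ * Equiv.swap s k) ?_ ?_ ?_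
      · intro σ hσ
        simp only [hB, hB', Finset.mem_filter, Finset.mem_univ, true_and,
          Finset.forall_mem_insert] at hσ ⊢
        exact ⟨hσ.2, fun t ht => (hinv s k t hs'.2 hkP hs'.1 (hk t ht) σ).2 (hσ.1 t ht)⟩
      · intro σ _ τ _ h
        exact mul_right_cancel h
      · intro τ hτ
        refine ⟨τ * Equiv.swap s k, ?_, by simp [mul_assoc]⟩
        simp only [hB, hB', Finset.mem_filter, Finset.mem_univ, true_and,
          Finset.forall_mem_insert] at hτ ⊢
        refine ⟨fun t ht => (hinv s k t hs'.2 hkP hs'.1 (hk t ht) τ).2 (hτ.2 t ht), ?_⟩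
        simpa [mul_assoc] using hτ.1
    -- Double counting of the pairs of an order in `B` and an exchange that makes `E k` hold.
    have hdouble : R.card * B'.card ≤ B.card * (R.card - q) := by
      calc R.card * B'.card = ∑ s ∈ R, (B.filter fun σ => E k (σ * Equiv.swap s k)).card := by
            rw [Finset.sum_congr rfl hs]; simp
        _ = ∑ σ ∈ B, (R.filter fun s => E k (σ * Equiv.swap s k)).card :=
            Finset.sum_card_bipartiteAbove_eq_sum_card_bipartiteBelow
              (fun s σ => E k (σ * Equiv.swap s k))
        _ ≤ ∑ _σ ∈ B, (R.card - q) := 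
            Finset.sum_le_sum fun σ _ => hcount σ _ (Finset.filter_subset _ _)
              fun s hs => (Finset.mem_filter.1 hs).2
        _ = B.card * (R.card - q) := by simp
    have hRn : R.card ≤ n := by simpa using Finset.card_le_univ R
    have hstep : (n : ℝ) * B'.card ≤ ((n : ℝ) - q) * B.card := by
      have hqn : (q : ℝ) ≤ n := by exact_mod_cast hq
      -- The factor obtained is `1 - q / R.card`; `B'.card ≤ B.card` weakens it to `1 - q / n`. For
      -- `R.card < q` the event is impossible.
      rcases le_or_gt q R.card with h | h
      · have h1 : (R.card : ℝ) * B'.card ≤ B.card * ((R.card : ℝ) - q) := by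
          rw [← Nat.cast_sub h]; exact_mod_cast hdouble
        have h2 : ((n : ℝ) - R.card) * B'.card ≤ ((n : ℝ) - R.card) * B.card :=
          mul_le_mul_of_nonneg_left (by exact_mod_cast hcardB)
            (sub_nonneg.2 (by exact_mod_cast hRn))
        linarith
      · have h0 : B'.card = 0 := by
          rw [Nat.sub_eq_zero_of_le h.le, mul_zero] at hdouble
          have : 0 < R.card := Finset.card_pos.2 ⟨k, hkR⟩
          rcases Nat.mul_eq_zero.1 (Nat.le_zero.1 hdouble) with h | h <;> omega
        rw [h0]
        simpa using mul_nonneg (sub_nonneg.2 hqn) (Nat.cast_nonneg B.card)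
    rw [Finset.card_insert_of_notMem hkT]
    have hqn : (0 : ℝ) ≤ (n : ℝ) - q := sub_nonneg.2 (by exact_mod_cast hq)
    calc (n : ℝ) ^ (T.card + 1) * (B'.card : ℝ) = (n : ℝ) ^ T.card * (n * B'.card) := by ring
      _ ≤ (n : ℝ) ^ T.card * (((n : ℝ) - q) * B.card) := by gcongr
      _ = ((n : ℝ) - q) * ((n : ℝ) ^ T.card * B.card) := by ring
      _ ≤ ((n : ℝ) - q) * (((n : ℝ) - q) ^ T.card * (n.factorial : ℝ)) := by gcongr
      _ = _ := by ring

open Classical in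
/-- The arrival orders for which the selected times could be exactly `P` although the game for
`m` selections remains rich at all times from `h` on. -/
noncomputable def stuckOrders {n : ℕ} (F : Finset (Finset (Fin n))) (q m h : ℕ) (P : Finset (Fin n)) :
    Finset (Equiv.Perm (Fin n)) :=
  Finset.univ.filter fun σ => ∀ t ∈ Finset.univ.filter fun t : Fin n => h ≤ (t : ℕ) ∧ t ∉ P,
    Rich F q (m - (P.filter (· < t)).card) ((Finset.Iic t).image σ)
      ((P.filter (· < t)).image σ) ∧
    ¬ Rich F q (m - (P.filter (· < t)).card - 1) ((Finset.Iic t).image σ)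
      (insert (σ t) ((P.filter (· < t)).image σ))

-- For fixed `P`, exchanging free positions up to `t` changes neither the set of arrivals up to `t`
-- nor the items selected before `t`. It only changes which free item arrives at `t`, and at least
-- `q` of these are good whenever the game is rich.
open Classical in
theorem card_stuckOrders_le {n : ℕ} (F : Finset (Finset (Fin n))) (q m h : ℕ)
    (P : Finset (Fin n)) (hP : P.card < m) (hq : q ≤ n) :
    (n : ℝ) ^ (Finset.univ.filter fun t : Fin n => h ≤ (t : ℕ) ∧ t ∉ P).card *
        ((stuckOrders F q m h P).card : ℝ)
      ≤ ((n : ℝ) - q) ^ (Finset.univ.filter fun t : Fin n => h ≤ (t : ℕ) ∧ t ∉ P).card *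
        (n.factorial : ℝ) := by
  have hW : ∀ s k t : Fin n, s ∉ P → k ∉ P → ∀ σ : Equiv.Perm (Fin n),
      (P.filter (· < t)).image (σ * Equiv.swap s k) = (P.filter (· < t)).image σ := by
    intro s k t hs hk σ
    refine Finset.image_congr fun x hx => ?_
    have hxP : x ∈ P := (Finset.mem_filter.1 hx).1
    rw [Equiv.Perm.mul_apply, Equiv.swap_apply_of_ne_of_ne]
    · rintro rfl; exact hs hxP
    · rintro rfl; exact hk hxP
  have hA : ∀ s k t : Fin n, s ≤ k → k ≤ t → ∀ σ : Equiv.Perm (Fin n),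
      (Finset.Iic t).image (σ * Equiv.swap s k) = (Finset.Iic t).image σ := by
    intro s k t hsk hkt σ
    rw [Equiv.Perm.coe_mul, ← Finset.image_image]
    congr 1
    have : (Finset.Iic t).image (Equiv.swap s k) ⊆ Finset.Iic t := by
      intro x hx
      obtain ⟨y, hy, rfl⟩ := Finset.mem_image.1 hx
      rw [Finset.mem_Iic] at hy ⊢
      rw [Equiv.swap_apply_def]
      split_ifs
      · exact hkt
      · exact hsk.trans hkt
      · exact hy
    exact Finset.eq_of_subset_of_card_le this
      (by rw [Finset.card_image_of_injective _ (Equiv.injective _)])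
  unfold stuckOrders
  have key := card_forall_perm_le P (Finset.univ.filter fun t : Fin n => h ≤ (t : ℕ) ∧ t ∉ P)
    (fun t ht => (Finset.mem_filter.1 ht).2.2) q hq
    (fun t σ => Rich F q (m - (P.filter (· < t)).card) ((Finset.Iic t).image σ)
        ((P.filter (· < t)).image σ) ∧
      ¬ Rich F q (m - (P.filter (· < t)).card - 1) ((Finset.Iic t).image σ)
        (insert (σ t) ((P.filter (· < t)).image σ))) ?_ ?_
  · convert key
  · intro s k t hs hk hsk hkt σ
    rw [hW s k t hs hk, hA s k t hsk hkt.le, Equiv.Perm.mul_apply, Equiv.swap_apply_of_ne_of_ne]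
    · exact (hsk.trans_lt hkt).ne'
    · exact hkt.ne'
  · intro k hk σ R' hR' hE'
    have hkP : k ∉ P := (Finset.mem_filter.1 hk).2.2
    set R := Finset.Iic k \ P with hR
    set W := (P.filter (· < k)).image σ with hWdef
    set A := (Finset.Iic k).image σ with hAdef
    -- Since `P.card < m`, at least one move is left and the truncated subtraction is exact.
    have hd : m - (P.filter (· < k)).card = (m - (P.filter (· < k)).card - 1) + 1 := by
      have := Finset.card_le_card (Finset.filter_subset (· < k) P)
      omega
    set d := m - (P.filter (· < k)).card - 1 with hddef
    have hE : ∀ s ∈ R, (Rich F q (m - (P.filter (· < k)).card)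
          ((Finset.Iic k).image (σ * Equiv.swap s k))
          ((P.filter (· < k)).image (σ * Equiv.swap s k)) ∧
        ¬ Rich F q d ((Finset.Iic k).image (σ * Equiv.swap s k))
          (insert ((σ * Equiv.swap s k) k) ((P.filter (· < k)).image (σ * Equiv.swap s k)))) ↔
        (Rich F q (d + 1) A W ∧ ¬ Rich F q d A (insert (σ s) W)) := by
      intro s hs
      have hs' : s ≤ k ∧ s ∉ P := by simpa [hR] using hs
      rw [hW s k k hs'.2 hkP, hA s k k hs'.1 le_rfl, Equiv.Perm.mul_apply,
        Equiv.swap_apply_right, hd]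
    refine (Finset.card_le_card
      (t := R.filter fun s => Rich F q (d + 1) A W ∧ ¬ Rich F q d A (insert (σ s) W)) ?_).trans ?_
    · exact fun s hs => Finset.mem_filter.2 ⟨hR' hs, (hE s (hR' hs)).1 (hE' s hs)⟩
    by_cases hrich : Rich F q (d + 1) A W
    -- A good choice lies in `A \ W`, so its position is at most `k` and outside `P`: times of `P`
    -- before `k` already belong to `W`, and `k ∉ P`.
    · have hle : q ≤ (R.filter fun s => Rich F q d A (insert (σ s) W)).card := by
        refine hrich.2.trans ((Finset.card_le_card (t := (R.filter fun s =>
          Rich F q d A (insert (σ s) W)).image σ) ?_).trans Finset.card_image_le)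
        intro i hi
        rw [Finset.mem_filter, Finset.mem_sdiff] at hi
        obtain ⟨⟨hiA, hiW⟩, hi2⟩ := hi
        obtain ⟨s, hs, rfl⟩ := Finset.mem_image.1 hiA
        rw [Finset.mem_Iic] at hs
        refine Finset.mem_image_of_mem _ (Finset.mem_filter.2 ⟨?_, hi2⟩)
        rw [hR, Finset.mem_sdiff, Finset.mem_Iic]
        refine ⟨hs, fun hsP => ?_⟩
        rcases hs.lt_or_eq with h | h
        · exact hiW (Finset.mem_image_of_mem _ (Finset.mem_filter.2 ⟨hsP, h⟩))
        · exact hkP (h ▸ hsP)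
      have hsplit := Finset.card_filter_add_card_filter_not (s := R)
        (fun s => Rich F q d A (insert (σ s) W))
      simp only [hrich, true_and]
      omega
    · simp [hrich]

/-! ### Positions of one or two items in a random order -/

theorem card_mul_card_filter_mem {G X : Type*} [Fintype G] [DecidableEq X] (f : G → X)
    (S R : Finset X) (hRS : R ⊆ S) (hf : ∀ g, f g ∈ S)
    (hfib : ∀ a ∈ S, ∀ b ∈ S, (Finset.univ.filter fun g => f g = a).card
      = (Finset.univ.filter fun g => f g = b).card) :
    S.card * (Finset.univ.filter fun g => f g ∈ R).card = R.card * Fintype.card G := by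
  rcases S.eq_empty_or_nonempty with rfl | ⟨a, ha⟩
  · rw [Finset.subset_empty.1 hRS]; simp
  have key : ∀ Q ⊆ S, (Finset.univ.filter fun g => f g ∈ Q).card
      = Q.card * (Finset.univ.filter fun g => f g = a).card := by
    intro Q hQ
    rw [Finset.card_eq_sum_card_fiberwise (f := f) (t := Q) (fun g hg => by simpa using hg),
      ← smul_eq_mul, ← Finset.sum_const]
    refine Finset.sum_congr rfl fun b hb => ?_
    rw [← hfib b (hQ hb) a ha, Finset.filter_filter]
    congr 1
    ext g
    simp only [Finset.mem_filter, Finset.mem_univ, true_and]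
    exact ⟨fun h => h.2, fun h => ⟨h ▸ hb, h⟩⟩
  have hS := key S subset_rfl
  rw [Finset.filter_true_of_mem fun g _ => hf g, Finset.card_univ] at hS
  rw [key R hRS, hS]
  ring

theorem card_perm_symm_apply_mem {n : ℕ} (i : Fin n) (R : Finset (Fin n)) :
    n * (Finset.univ.filter fun σ : Equiv.Perm (Fin n) => σ.symm i ∈ R).card
      = R.card * n.factorial := by
  have := card_mul_card_filter_mem (fun σ : Equiv.Perm (Fin n) => σ.symm i) Finset.univ R
    (Finset.subset_univ _) (fun _ => Finset.mem_univ _) ?_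
  · simpa [Fintype.card_perm] using this
  · intro a _ b _
    refine Finset.card_bij (fun σ _ => σ * Equiv.swap a b) ?_ ?_ ?_
    · intro σ hσ
      simp only [Finset.mem_filter, Finset.mem_univ, true_and, Equiv.symm_apply_eq] at hσ ⊢
      simpa using hσ
    · exact fun σ _ τ _ h => mul_right_cancel h
    · intro σ hσ
      refine ⟨σ * Equiv.swap a b, ?_, by simp [mul_assoc]⟩
      simp only [Finset.mem_filter, Finset.mem_univ, true_and, Equiv.symm_apply_eq] at hσ ⊢
      simpa using hσ

theorem exists_perm_apply_eq_and {α : Type*} [DecidableEq α] {a b c d : α} (hab : a ≠ b)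
    (hcd : c ≠ d) : ∃ τ : Equiv.Perm α, τ c = a ∧ τ d = b := by
  refine ⟨Equiv.swap (Equiv.swap c a d) b * Equiv.swap c a, ?_, by simp⟩
  rw [Equiv.Perm.mul_apply, Equiv.swap_apply_left, Equiv.swap_apply_of_ne_of_ne _ hab]
  intro h
  apply hcd
  apply (Equiv.swap c a).injective
  rw [← h, Equiv.swap_apply_left]

theorem card_perm_symm_apply_pair_mem {n : ℕ} {i j : Fin n} (hij : i ≠ j)
    (R : Finset (Fin n × Fin n)) (hR : ∀ p ∈ R, p.1 ≠ p.2) :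
    (n * n - n) *
        (Finset.univ.filter fun σ : Equiv.Perm (Fin n) => (σ.symm i, σ.symm j) ∈ R).card
      = R.card * n.factorial := by
  have := card_mul_card_filter_mem (fun σ : Equiv.Perm (Fin n) => (σ.symm i, σ.symm j))
    Finset.univ.offDiag R (fun p hp => by simpa using hR p hp) (fun σ => by simpa using hij) ?_
  · simpa [Fintype.card_perm, Finset.offDiag_card] using this
  · rintro ⟨a, b⟩ hab ⟨c, d⟩ hcd
    have hab' : a ≠ b := by simpa using hab
    have hcd' : c ≠ d := by simpa using hcd
    obtain ⟨τ, h1, h2⟩ := exists_perm_apply_eq_and hab' hcd'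
    refine Finset.card_bij (fun σ _ => σ * τ) ?_ ?_ ?_
    · intro σ hσ
      simp only [Finset.mem_filter, Finset.mem_univ, true_and, Prod.mk.injEq,
        Equiv.symm_apply_eq] at hσ ⊢
      simpa [h1, h2] using hσ
    · exact fun σ _ σ' _ h => mul_right_cancel h
    · intro σ hσ
      refine ⟨σ * τ⁻¹, ?_, by simp [mul_assoc]⟩
      simp only [Finset.mem_filter, Finset.mem_univ, true_and, Prod.mk.injEq,
        Equiv.symm_apply_eq] at hσ ⊢
      simpa [← h1, ← h2] using hσ

theorem card_fin_lt {n h : ℕ} (hn : h ≤ n) :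
    (Finset.univ.filter fun t : Fin n => (t : ℕ) < h).card = h := by
  rw [Fin.card_filter_val_lt]; omega

theorem card_fin_ge {n h : ℕ} (hn : h ≤ n) :
    (Finset.univ.filter fun t : Fin n => h ≤ (t : ℕ)).card = n - h := by
  have h1 := Finset.card_filter_add_card_filter_not (s := (Finset.univ : Finset (Fin n)))
    (fun t : Fin n => (t : ℕ) < h)
  rw [card_fin_lt hn] at h1
  simp only [not_lt, Finset.card_univ, Fintype.card_fin] at h1
  omega

/-- A given pair of distinct items arrives in the second and in the first half, respectively, with
probability at least `1 / 4`. -/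
theorem factorial_le_four_mul_card {n : ℕ} {i j : Fin n} (hij : i ≠ j) :
    n.factorial ≤ 4 * (Finset.univ.filter fun σ : Equiv.Perm (Fin n) =>
      n / 2 ≤ (σ.symm i : ℕ) ∧ (σ.symm j : ℕ) < n / 2).card := by
  have h2 : 2 ≤ n := by
    have h1 := i.isLt
    have h2 := j.isLt
    have h3 : (i : ℕ) ≠ j := fun h => hij (Fin.ext h)
    omega
  have key := card_perm_symm_apply_pair_mem hij
    ((Finset.univ.filter fun t : Fin n => n / 2 ≤ (t : ℕ)) ×ˢ
      (Finset.univ.filter fun t : Fin n => (t : ℕ) < n / 2)) ?_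
  · rw [Finset.card_product, card_fin_lt (Nat.div_le_self _ _),
      card_fin_ge (Nat.div_le_self _ _)] at key
    simp only [Finset.mem_product, Finset.mem_filter, Finset.mem_univ, true_and] at key
    set N := (Finset.univ.filter fun σ : Equiv.Perm (Fin n) =>
      n / 2 ≤ (σ.symm i : ℕ) ∧ (σ.symm j : ℕ) < n / 2).card
    have hq : n * n - n ≤ 4 * ((n - n / 2) * (n / 2)) := by
      rcases Nat.even_or_odd' n with ⟨k, rfl | rfl⟩
      · rw [show 2 * k / 2 = k by omega, show 2 * k - k = k by omega, Nat.sub_le_iff_le_add]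
        nlinarith
      · rw [show (2 * k + 1) / 2 = k by omega, show 2 * k + 1 - k = k + 1 by omega,
          Nat.sub_le_iff_le_add]
        nlinarith
    have hpos : 0 < n * n - n := by
      have : n * 2 ≤ n * n := Nat.mul_le_mul_left n h2
      omega
    refine Nat.le_of_mul_le_mul_left ?_ hpos
    calc (n * n - n) * n.factorial ≤ 4 * ((n - n / 2) * (n / 2)) * n.factorial := by gcongr
      _ = 4 * ((n - n / 2) * (n / 2) * n.factorial) := by ring
      _ = 4 * ((n * n - n) * N) := by rw [key]
      _ = _ := by ring
  · rintro ⟨a, b⟩ hp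
    simp only [Finset.mem_product, Finset.mem_filter, Finset.mem_univ, true_and] at hp
    intro h
    simp only at h
    subst h
    omega

/-! ### Harmonic and logarithmic estimates -/

/-- The least of the `S.card` values is at most `V / S.card`; remove it and repeat. -/
theorem sum_le_mul_harmonic {α : Type*} [DecidableEq α] (y : α → ℝ) (V : ℝ) (S : Finset α)
    (hV : ∀ T ⊆ S, ∀ a ∈ T, (∀ j ∈ T, y a ≤ y j) → T.card * y a ≤ V) :
    ∑ i ∈ S, y i ≤ V * (harmonic S.card : ℝ) := by
  induction hk : S.card generalizing S with
  | zero => simp [Finset.card_eq_zero.1 hk]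
  | succ k ih =>
    obtain ⟨a, ha, hmin⟩ := S.exists_min_image y (Finset.card_pos.1 (by omega))
    have h1 := hV S subset_rfl a ha hmin
    have h2 := ih (S.erase a) (fun T hT => hV T (hT.trans (Finset.erase_subset _ _)))
      (by rw [Finset.card_erase_of_mem ha]; omega)
    rw [← Finset.sum_erase_add _ _ ha, harmonic_succ]
    push_cast
    rw [mul_add, ← div_eq_mul_inv]
    refine add_le_add h2 ?_
    rw [le_div_iff₀ (by positivity)]
    rw [hk] at h1
    push_cast at h1
    linarith

theorem harmonic_le_two_mul_max_logb (r : ℕ) :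
    (harmonic r : ℝ) ≤ 2 * max 1 (Real.logb 2 r) := by
  have h1 := harmonic_le_one_add_log r
  have h2 : Real.log r ≤ max 1 (Real.logb 2 r) := by
    have h0 : 0 ≤ Real.log r := Real.log_natCast_nonneg r
    have h3 : Real.log r ≤ Real.logb 2 r := by
      unfold Real.logb
      rw [le_div_iff₀ (Real.log_pos one_lt_two)]
      have := Real.log_two_lt_d9
      nlinarith
    exact h3.trans (le_max_right _ _)
  have h4 : (1 : ℝ) ≤ max 1 (Real.logb 2 r) := le_max_left _ _
  linarith

theorem harmonic_mono : Monotone harmonic := by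
  refine monotone_nat_of_le_succ fun n => ?_
  rw [harmonic_succ]
  have : (0 : ℚ) ≤ (((n + 1 : ℕ) : ℚ))⁻¹ := by positivity
  linarith

theorem natLog_add_one_le (n : ℕ) :
    ((Nat.log 2 n + 1 : ℕ) : ℝ) ≤ 2 * max 1 (Real.logb 2 n) := by
  have h1 : ((Nat.log 2 n : ℕ) : ℝ) ≤ Real.logb 2 n := by
    have := Real.natLog_le_logb n 2
    simpa using this
  have h2 : (1 : ℝ) ≤ max 1 (Real.logb 2 n) := le_max_left _ _
  have h3 : Real.logb 2 n ≤ max 1 (Real.logb 2 n) := le_max_right _ _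
  push_cast
  linarith

/-! ### The quota and the union bound over stuck orders -/

/-- The number of items that the threshold rule tries to select when the sample contains a feasible
set of `k` items above the threshold. -/
def quota (n k : ℕ) : ℕ := k / (17 * (Nat.log 2 n + 1))

theorem quota_mul_le (n k : ℕ) : quota n k * (17 * (Nat.log 2 n + 1)) ≤ k :=
  Nat.div_mul_le_self _ _

theorem lt_quota_add_one_mul (n k : ℕ) : k < (quota n k + 1) * (17 * (Nat.log 2 n + 1)) := by
  have := Nat.lt_mul_div_succ k (b := 17 * (Nat.log 2 n + 1)) (by positivity)
  rw [mul_comm]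
  exact this

theorem quota_mul_seventeen_le (n k : ℕ) : quota n k * 17 ≤ k :=
  le_trans (Nat.mul_le_mul_left _ (by omega)) (quota_mul_le n k)

theorem card_stuckOrders_le_exp {n k : ℕ} (hn : 2 ≤ n) (hk : k ≤ n)
    (F : Finset (Finset (Fin n))) (P : Finset (Fin n)) (hP : P.card < quota n k) :
    ((stuckOrders F (k - quota n k) (quota n k) (n / 2) P).card : ℝ)
      ≤ Real.exp (-((k - quota n k : ℕ) : ℝ) / 4) * (n.factorial : ℝ) := by
  set m := quota n k with hm
  set q := k - m with hqdef
  have hm17 : m * 17 ≤ k := quota_mul_seventeen_le n k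
  have hq : q ≤ n := by omega
  have key := card_stuckOrders_le F q m (n / 2) P hP hq
  set T := Finset.univ.filter fun t : Fin n => n / 2 ≤ (t : ℕ) ∧ t ∉ P with hT
  -- The second half has at least `n / 2` times, and `P` removes fewer than `n / 17` of them.
  have hTcard : n ≤ 4 * T.card := by
    have h1 := Finset.card_le_card (s := Finset.univ.filter fun t : Fin n => n / 2 ≤ (t : ℕ))
      (t := T ∪ P) (by
        intro t ht
        by_cases htP : t ∈ P
        · exact Finset.mem_union_right _ htP
        · exact Finset.mem_union_left _ (by simpa [hT, htP] using ht))
    rw [card_fin_ge (Nat.div_le_self _ _)] at h1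
    have h2 := Finset.card_union_le T P
    omega
  have hn0 : (0 : ℝ) < n := by exact_mod_cast (by omega : 0 < n)
  have h1 : (n : ℝ) - q ≤ n * Real.exp (-(q : ℝ) / n) := by
    have h := Real.add_one_le_exp (-(q : ℝ) / n)
    calc (n : ℝ) - q = n * (-(q : ℝ) / n + 1) := by field_simp; ring
      _ ≤ _ := by gcongr
  have h0 : (0 : ℝ) ≤ (n : ℝ) - q := sub_nonneg.2 (by exact_mod_cast hq)
  have h2 : ((n : ℝ) - q) ^ T.card ≤ (n : ℝ) ^ T.card * Real.exp (-(q : ℝ) / 4) := by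
    calc ((n : ℝ) - q) ^ T.card ≤ (n * Real.exp (-(q : ℝ) / n)) ^ T.card := by gcongr
      _ = (n : ℝ) ^ T.card * Real.exp (T.card * (-(q : ℝ) / n)) := by
        rw [mul_pow, Real.exp_nat_mul]
      _ ≤ _ := by
        gcongr
        rw [mul_div_assoc', div_le_div_iff₀ hn0 (by norm_num)]
        have : (n : ℝ) ≤ 4 * T.card := by exact_mod_cast hTcard
        have hq0 : (0 : ℝ) ≤ q := Nat.cast_nonneg q
        nlinarith
  have h3 : (0 : ℝ) < (n : ℝ) ^ T.card := by positivity
  refine le_of_mul_le_mul_left ?_ h3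
  calc _ ≤ _ := key
    _ ≤ (n : ℝ) ^ T.card * Real.exp (-(q : ℝ) / 4) * (n.factorial : ℝ) := by gcongr
    _ = _ := by ring

theorem card_filter_card_lt_le {n : ℕ} (hn : 2 ≤ n) (m : ℕ) :
    (Finset.univ.filter fun P : Finset (Fin n) => P.card < m).card ≤ n ^ m := by
  calc (Finset.univ.filter fun P : Finset (Fin n) => P.card < m).card
      = ∑ j ∈ Finset.range m, (Finset.univ.filter fun P : Finset (Fin n) => P.card = j).card := by
        rw [Finset.card_eq_sum_card_fiberwise (f := Finset.card) (t := Finset.range m)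
          (fun P hP => by simpa using hP)]
        refine Finset.sum_congr rfl fun j hj => ?_
        rw [Finset.filter_filter]
        congr 1
        ext P
        simp only [Finset.mem_filter, Finset.mem_univ, true_and, Finset.mem_range] at hj ⊢
        omega
    _ ≤ ∑ j ∈ Finset.range m, n ^ j := by
        refine Finset.sum_le_sum fun j _ => ?_
        have : (Finset.univ.filter fun P : Finset (Fin n) => P.card = j)
            = Finset.powersetCard j Finset.univ := by
          ext P; simp [Finset.mem_powersetCard]
        rw [this, Finset.card_powersetCard, Finset.card_univ, Fintype.card_fin]
        exact Nat.choose_le_pow n j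
    _ ≤ n ^ m := (Nat.geomSum_lt hn fun j hj => Finset.mem_range.1 hj).le

/-- The factor 17 in `quota` is chosen for this. `n ^ quota n k` pays for the sets `P`, two more
factors `n` for the pairs of threshold item and size, and the last one leaves total probability `1 /
n`. -/
theorem pow_mul_exp_le_one {n k : ℕ} (hn : 2 ≤ n) (hm : 0 < quota n k) :
    (n : ℝ) ^ (quota n k + 3) * Real.exp (-((k - quota n k : ℕ) : ℝ) / 4) ≤ 1 := by
  have hk := quota_mul_le n k
  set m := quota n k
  set L := Nat.log 2 n + 1 with hL
  have hL1 : 1 ≤ L := by omega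
  have hnL : (n : ℝ) ≤ Real.exp L := by
    have h1 : n < 2 ^ L := Nat.lt_pow_succ_log_self one_lt_two n
    have h2 : (2 : ℝ) ≤ Real.exp 1 := by
      have := Real.add_one_le_exp (1 : ℝ); linarith
    calc (n : ℝ) ≤ (2 : ℝ) ^ L := by exact_mod_cast h1.le
      _ ≤ Real.exp 1 ^ L := by gcongr
      _ = Real.exp L := by rw [← Real.exp_nat_mul, mul_one]
  have hq : 16 * (m * L) ≤ k - m := by
    have : m * 1 ≤ m * L := Nat.mul_le_mul_left m hL1
    have h2 : m * (17 * L) = 17 * (m * L) := by ring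
    omega
  have hq' : 16 * ((m : ℝ) * L) ≤ ((k - m : ℕ) : ℝ) := by exact_mod_cast hq
  have hn1 : (1 : ℝ) ≤ n := by exact_mod_cast (by omega : 1 ≤ n)
  -- Here `m + 3 ≤ 4 * m` because `m` is positive; then `n ≤ exp L` and `k - m ≥ 16 * m * L` balance
  -- exactly.
  calc (n : ℝ) ^ (m + 3) * Real.exp (-((k - m : ℕ) : ℝ) / 4)
      ≤ (n : ℝ) ^ (4 * m) * Real.exp (-((k - m : ℕ) : ℝ) / 4) := by
        gcongr
        omega
    _ ≤ Real.exp L ^ (4 * m) * Real.exp (-((k - m : ℕ) : ℝ) / 4) := by gcongr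
    _ = Real.exp (((4 * m : ℕ) : ℝ) * L + -((k - m : ℕ) : ℝ) / 4) := by
        rw [← Real.exp_nat_mul, Real.exp_add]
    _ ≤ 1 := by
        rw [Real.exp_le_one_iff]
        push_cast
        linarith

/-- All arrival orders on which the threshold rule could get stuck before reaching its quota, for
some family `F a` and some sample size `k`. -/
noncomputable def badOrders {n : ℕ} (F : Fin n → Finset (Finset (Fin n))) :
    Finset (Equiv.Perm (Fin n)) :=
  (Finset.univ ×ˢ ((Finset.Icc 1 n).filter fun k => 0 < quota n k)).biUnion fun p =>
    (Finset.univ.filter fun P : Finset (Fin n) => P.card < quota n p.2).biUnion fun P =>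
      stuckOrders (F p.1) (p.2 - quota n p.2) (quota n p.2) (n / 2) P

theorem mem_badOrders {n : ℕ} (F : Fin n → Finset (Finset (Fin n))) (a : Fin n) {k : ℕ}
    (hkn : k ≤ n) (P : Finset (Fin n)) (hP : P.card < quota n k) {σ : Equiv.Perm (Fin n)}
    (hσ : σ ∈ stuckOrders (F a) (k - quota n k) (quota n k) (n / 2) P) : σ ∈ badOrders F := by
  have h1 := quota_mul_seventeen_le n k
  refine Finset.mem_biUnion.2 ⟨(a, k), ?_, Finset.mem_biUnion.2 ⟨P, ?_, hσ⟩⟩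
  · simp only [Finset.mem_product, Finset.mem_univ, Finset.mem_filter, Finset.mem_Icc, true_and]
    omega
  · simpa using hP

theorem card_badOrders_mul_le {n : ℕ} (hn : 2 ≤ n) (F : Fin n → Finset (Finset (Fin n))) :
    (n : ℝ) * ((badOrders F).card : ℝ) ≤ (n.factorial : ℝ) := by
  have hn0 : (0 : ℝ) < n := by exact_mod_cast (by omega : 0 < n)
  have h1 : ((badOrders F).card : ℝ) ≤ ∑ p ∈ (Finset.univ : Finset (Fin n)) ×ˢ
      ((Finset.Icc 1 n).filter fun k => 0 < quota n k), (n.factorial : ℝ) / (n : ℝ) ^ 3 := by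
    unfold badOrders
    refine (Nat.cast_le.2 Finset.card_biUnion_le).trans ?_
    push_cast
    refine Finset.sum_le_sum fun p hp => ?_
    obtain ⟨a, k⟩ := p
    simp only [Finset.mem_product, Finset.mem_univ, Finset.mem_filter, Finset.mem_Icc,
      true_and] at hp
    refine (Nat.cast_le.2 Finset.card_biUnion_le).trans ?_
    push_cast
    calc _ ≤ ∑ _P ∈ Finset.univ.filter fun P : Finset (Fin n) => P.card < quota n k,
          Real.exp (-((k - quota n k : ℕ) : ℝ) / 4) * (n.factorial : ℝ) :=
          Finset.sum_le_sum fun P hP =>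
            card_stuckOrders_le_exp hn hp.1.2 _ P (Finset.mem_filter.1 hP).2
      _ ≤ (n : ℝ) ^ quota n k *
          (Real.exp (-((k - quota n k : ℕ) : ℝ) / 4) * (n.factorial : ℝ)) := by
          rw [Finset.sum_const, nsmul_eq_mul]
          gcongr
          exact_mod_cast card_filter_card_lt_le hn _
      _ ≤ (n.factorial : ℝ) / (n : ℝ) ^ 3 := by
          rw [le_div_iff₀ (by positivity)]
          calc _ = ((n : ℝ) ^ (quota n k + 3) *
                Real.exp (-((k - quota n k : ℕ) : ℝ) / 4)) * (n.factorial : ℝ) := by ring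
            _ ≤ 1 * (n.factorial : ℝ) := by
                gcongr
                exact pow_mul_exp_le_one hn hp.2
            _ = _ := one_mul _
  rw [Finset.sum_const, nsmul_eq_mul] at h1
  have h2 : (((Finset.univ : Finset (Fin n)) ×ˢ
      ((Finset.Icc 1 n).filter fun k => 0 < quota n k)).card : ℝ) ≤ (n : ℝ) ^ 2 := by
    have : ((Finset.univ : Finset (Fin n)) ×ˢ
      ((Finset.Icc 1 n).filter fun k => 0 < quota n k)).card ≤ n ^ 2 := by
      rw [Finset.card_product, Finset.card_univ, Fintype.card_fin, sq]
      refine Nat.mul_le_mul_left n ((Finset.card_filter_le _ _).trans ?_)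
      simp
    exact_mod_cast this
  calc (n : ℝ) * ((badOrders F).card : ℝ)
      ≤ n * ((n : ℝ) ^ 2 * ((n.factorial : ℝ) / (n : ℝ) ^ 3)) := by
        gcongr
        exact h1.trans (by gcongr)
    _ = n.factorial := by field_simp

/-! ### The algorithm -/

namespace SecretaryView

variable {n : ℕ}

open Classical in
/-- The feasible sets with all values at least `x`. -/
noncomputable def above (v : SecretaryView n) (x : ℝ) : Finset (Finset (Fin n)) :=
  v.feasible.filter fun S => ∀ j ∈ S, x ≤ v.value j

open Classical in
/-- The pairs consisting of the minimum value and the size of a feasible set of items from the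
sample, i.e. the items that arrived before time `h`, and the pair `(0, 0)`. -/
noncomputable def sampleTargets (h : ℕ) (v : SecretaryView n) : Finset (ℝ × ℕ) :=
  insert (0, 0) (((Finset.univ ×ˢ v.feasible).filter fun p : Fin n × Finset (Fin n) =>
    p.1 ∈ p.2 ∧ (∀ j ∈ p.2, (j : ℕ) < h ∧ v.value p.1 ≤ v.value j)).image
      fun p => (v.value p.1, p.2.card))

theorem exists_bestTarget (T : Finset (ℝ × ℕ)) :
    ∃ p : ℝ × ℕ, T.Nonempty → p ∈ T ∧ ∀ p' ∈ T, (p'.2 : ℝ) * p'.1 ≤ p.2 * p.1 := by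
  by_cases h : T.Nonempty
  · obtain ⟨p, hp, hmax⟩ := T.exists_max_image (fun p => (p.2 : ℝ) * p.1) h
    exact ⟨p, fun _ => ⟨hp, hmax⟩⟩
  · exact ⟨0, fun h' => absurd h' h⟩

/-- A pair in `T` whose product is maximal. -/
noncomputable def bestTarget (T : Finset (ℝ × ℕ)) : ℝ × ℕ := (exists_bestTarget T).choose

theorem bestTarget_spec {T : Finset (ℝ × ℕ)} (h : T.Nonempty) :
    bestTarget T ∈ T ∧ ∀ p ∈ T, (p.2 : ℝ) * p.1 ≤ (bestTarget T).2 * (bestTarget T).1 :=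
  (exists_bestTarget T).choose_spec h

/-- The three rules: the secretary rules that wait for one item which beats the best sampled item
strictly or weakly, and the threshold rule that aims at many items. -/
def Rule (v : SecretaryView n) : Fin 3 → Prop
  | 0 => v.selected = ∅ ∧ ∀ j : Fin n, (j : ℕ) < n / 2 → {j} ∈ v.feasible →
      v.value j < v.value v.time
  | 1 => v.selected = ∅ ∧ ∀ j : Fin n, (j : ℕ) < n / 2 → {j} ∈ v.feasible →
      v.value j ≤ v.value v.time
  | 2 =>
    let p := bestTarget (v.sampleTargets (n / 2))
    v.selected.card < quota n p.2 ∧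
      Rich (v.above p.1) (p.2 - quota n p.2) (quota n p.2 - v.selected.card - 1)
        (Finset.Iic v.time) (insert v.time v.selected)

end SecretaryView

open Classical in
/-- The algorithm that follows one of the three rules, chosen at random, after a sampling phase that
lasts for the first half of the arrivals. -/
noncomputable def threeRules (n : ℕ) : RandomizedSecretaryAlgorithm n where
  Seed := Fin 3
  prob _ := 1 / 3
  prob_nonneg _ := by norm_num
  prob_sum := by simp
  accept s v := decide (n / 2 ≤ (v.time : ℕ) ∧ insert v.time v.selected ∈ v.feasible ∧ v.Rule s)

/-! ### The selection process of an arbitrary algorithm -/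

namespace RandomizedSecretaryAlgorithm

variable {n : ℕ} (A : RandomizedSecretaryAlgorithm n) (I : SecretaryInstance n) (s : A.Seed)
  (σ : Equiv.Perm (Fin n))

theorem mem_selectedTimes {k : ℕ} {t : Fin n} : t ∈ A.selectedTimes I s σ k ↔
    (t : ℕ) < k ∧ A.accept s (I.view σ t (A.selectedTimes I s σ t)) = true := by
  induction k with
  | zero => simp [selectedTimes]
  | succ k ih =>
    have hlt : (t : ℕ) < k + 1 ↔ (t : ℕ) < k ∨ (t : ℕ) = k := by omega
    rw [selectedTimes]
    by_cases hk : k < n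
    · by_cases htk : (t : ℕ) = k
      · subst htk
        split_ifs with h <;> simp [ih, h]
      · have hne : t ≠ ⟨k, hk⟩ := fun h => htk (by rw [h])
        split_ifs with h <;> simp [ih, hne, hlt, htk]
    · have htk : (t : ℕ) ≠ k := by omega
      simp [hk, ih, hlt, htk]

theorem filter_selectedTimes_lt (t : Fin n) :
    (A.selectedTimes I s σ n).filter (· < t) = A.selectedTimes I s σ t := by
  ext j
  simp only [Finset.mem_filter, mem_selectedTimes, Fin.lt_def]
  have := j.isLt
  tauto

theorem selectedTimes_succ (t : Fin n) : A.selectedTimes I s σ (t + 1) =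
    if A.accept s (I.view σ t (A.selectedTimes I s σ t)) = true
      then insert t (A.selectedTimes I s σ t) else A.selectedTimes I s σ t := by
  rw [selectedTimes]
  simp

/-- The value obtained for a given seed and arrival order. -/
noncomputable def gain : ℝ := ∑ i ∈ A.selectedItems I s σ n, I.value i

theorem gain_nonneg : 0 ≤ A.gain I s σ := Finset.sum_nonneg fun i _ => I.value_nonneg i

theorem gain_eq : A.gain I s σ = ∑ t ∈ A.selectedTimes I s σ n, I.value (σ t) :=
  Finset.sum_image fun _ _ _ _ h => σ.injective h

end RandomizedSecretaryAlgorithm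

open Classical in
theorem SecretaryInstance.image_mem_of_mem_view_feasible {n : ℕ} {I : SecretaryInstance n}
    {σ : Equiv.Perm (Fin n)} {t : Fin n} {W S : Finset (Fin n)} :
    S ∈ (I.view σ t W).feasible ↔ (∀ j ∈ S, j ≤ t) ∧ S.image σ ∈ I.feasible := by
  simp [SecretaryInstance.view]

/-! ### Feasibility and the secretary rules -/

section

variable {n : ℕ} (I : SecretaryInstance n) (σ : Equiv.Perm (Fin n))

open RandomizedSecretaryAlgorithm

theorem threeRules_accept_iff (s : Fin 3) (v : SecretaryView n) :
    (threeRules n).accept s v = true ↔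
      n / 2 ≤ (v.time : ℕ) ∧ insert v.time v.selected ∈ v.feasible ∧ v.Rule s := by
  simp [threeRules]

theorem threeRules_maintainsFeasibility (n : ℕ) : (threeRules n).MaintainsFeasibility := by
  intro I s σ k
  unfold selectedItems
  induction k with
  | zero =>
    obtain ⟨S, hS⟩ := I.nonempty
    simpa [selectedTimes] using I.downwardClosed S hS ∅ (Finset.empty_subset _)
  | succ k ih =>
    rw [selectedTimes]
    split_ifs with hk hacc
    · replace hacc := (threeRules_accept_iff _ _).1 hacc
      exact (SecretaryInstance.image_mem_of_mem_view_feasible.1 hacc.2.1).2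
    · exact ih
    · exact ih

theorem threeRules_expectedValue (I : SecretaryInstance n) :
    3 * (n.factorial : ℝ) * (threeRules n).expectedValue I =
      (∑ σ, (threeRules n).gain I (0 : Fin 3) σ) + (∑ σ, (threeRules n).gain I (1 : Fin 3) σ)
        + ∑ σ, (threeRules n).gain I (2 : Fin 3) σ := by
  have h0 : (n.factorial : ℝ) ≠ 0 := by positivity
  have : (threeRules n).expectedValue I = ∑ s : Fin 3, (1 / 3 : ℝ) *
      ((∑ σ, (threeRules n).gain I s σ) / (n.factorial : ℝ)) := rfl
  rw [this, Fin.sum_univ_three]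
  field_simp

/-- A secretary rule gets at least `b` if the item arriving at time `t₀` would be accepted as the
first item, and all items that would be are worth at least `b`. -/
theorem le_gain_of_first (s : Fin 3) (b : ℝ) (t₀ : Fin n) (ht₀ : n / 2 ≤ (t₀ : ℕ))
    (hfeas : {σ t₀} ∈ I.feasible) (hrule : (I.view σ t₀ ∅).Rule s)
    (hb : ∀ t : Fin n, n / 2 ≤ (t : ℕ) → {σ t} ∈ I.feasible →
      (∃ W, (I.view σ t W).Rule s) → b ≤ I.value (σ t)) :
    b ≤ (threeRules n).gain I s σ := by
  have hex : ∃ t, t ∈ (threeRules n).selectedTimes I s σ n := by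
    by_cases hW : (threeRules n).selectedTimes I s σ t₀ = ∅
    · refine ⟨t₀, (mem_selectedTimes _ _ _ _).2 ⟨t₀.isLt, ?_⟩⟩
      rw [hW, threeRules_accept_iff]
      refine ⟨ht₀, SecretaryInstance.image_mem_of_mem_view_feasible.2 ?_, hrule⟩
      simpa [SecretaryInstance.view] using hfeas
    · obtain ⟨t, ht⟩ := Finset.nonempty_iff_ne_empty.2 hW
      exact ⟨t, (mem_selectedTimes _ _ _ _).2 ⟨t.isLt, ((mem_selectedTimes _ _ _ _).1 ht).2⟩⟩
  obtain ⟨t, ht⟩ := hex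
  have hacc := ((mem_selectedTimes _ _ _ _).1 ht).2
  replace hacc := (threeRules_accept_iff _ _).1 hacc
  have h2 := (SecretaryInstance.image_mem_of_mem_view_feasible.1 hacc.2.1).2
  have h3 : {σ t} ∈ I.feasible := I.downwardClosed _ h2 _ (by simp [SecretaryInstance.view])
  refine (hb t hacc.1 h3 ⟨_, hacc.2.2⟩).trans ?_
  refine le_of_le_of_eq ?_ (gain_eq (threeRules n) I s σ).symm
  exact Finset.single_le_sum (f := fun t => I.value (σ t)) (fun i _ => I.value_nonneg _) ht

theorem view_rule_zero {t : Fin n} {W : Finset (Fin n)} (ht : n / 2 ≤ (t : ℕ)) :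
    (I.view σ t W).Rule 0 ↔ W = ∅ ∧ ∀ j : Fin n, (j : ℕ) < n / 2 → {σ j} ∈ I.feasible →
      I.value (σ j) < I.value (σ t) := by
  refine and_congr Iff.rfl (forall_congr' fun j => forall_congr' fun hj => ?_)
  have hjt : j ≤ t := Fin.le_def.2 (by omega)
  rw [SecretaryInstance.image_mem_of_mem_view_feasible]
  simp [SecretaryInstance.view, hjt]

theorem view_rule_one {t : Fin n} {W : Finset (Fin n)} (ht : n / 2 ≤ (t : ℕ)) :
    (I.view σ t W).Rule 1 ↔ W = ∅ ∧ ∀ j : Fin n, (j : ℕ) < n / 2 → {σ j} ∈ I.feasible →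
      I.value (σ j) ≤ I.value (σ t) := by
  refine and_congr Iff.rfl (forall_congr' fun j => forall_congr' fun hj => ?_)
  have hjt : j ≤ t := Fin.le_def.2 (by omega)
  rw [SecretaryInstance.image_mem_of_mem_view_feasible]
  simp [SecretaryInstance.view, hjt]

theorem le_gain_weak {i : Fin n} (hi : {i} ∈ I.feasible)
    (hmax : ∀ j, {j} ∈ I.feasible → I.value j ≤ I.value i) (hpos : n / 2 ≤ (σ.symm i : ℕ))
    (hb : ∀ t : Fin n, (∀ j : Fin n, (j : ℕ) < n / 2 → {σ j} ∈ I.feasible →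
      I.value (σ j) ≤ I.value (σ t)) → {σ t} ∈ I.feasible → I.value i ≤ I.value (σ t)) :
    I.value i ≤ (threeRules n).gain I (1 : Fin 3) σ := by
  refine le_gain_of_first I σ 1 _ (σ.symm i) hpos (by simpa using hi) ?_ ?_
  · rw [view_rule_one I σ hpos]
    exact ⟨rfl, fun j _ hj => by simpa using hmax _ hj⟩
  · rintro t ht htf ⟨W, hW⟩
    exact hb t ((view_rule_one I σ ht).1 hW).2 htf

theorem le_gain_strict {i : Fin n} (hi : {i} ∈ I.feasible) (hpos : n / 2 ≤ (σ.symm i : ℕ))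
    (hlt : ∀ j : Fin n, (j : ℕ) < n / 2 → {σ j} ∈ I.feasible → I.value (σ j) < I.value i)
    (hb : ∀ t : Fin n, (∀ j : Fin n, (j : ℕ) < n / 2 → {σ j} ∈ I.feasible →
      I.value (σ j) < I.value (σ t)) → {σ t} ∈ I.feasible → I.value i ≤ I.value (σ t)) :
    I.value i ≤ (threeRules n).gain I (0 : Fin 3) σ := by
  refine le_gain_of_first I σ 0 _ (σ.symm i) hpos (by simpa using hi) ?_ ?_
  · rw [view_rule_zero I σ hpos]
    exact ⟨rfl, fun j hj hjf => by simpa using hlt j hj hjf⟩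
  · rintro t ht htf ⟨W, hW⟩
    exact hb t ((view_rule_zero I σ ht).1 hW).2 htf

/-- The secretary rules get a quarter of the best feasible item. -/
theorem value_mul_factorial_le (hn : 2 ≤ n) {i : Fin n} (hi : {i} ∈ I.feasible)
    (hmax : ∀ j, {j} ∈ I.feasible → I.value j ≤ I.value i) :
    I.value i * (n.factorial : ℝ) ≤ 4 * ((∑ σ, (threeRules n).gain I (0 : Fin 3) σ)
      + ∑ σ, (threeRules n).gain I (1 : Fin 3) σ) := by
  classical
  -- `i₂` is the second best feasible item, or any other item if `i` is the only feasible one.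
  obtain ⟨i₂, hne, h₂⟩ : ∃ i₂, i₂ ≠ i ∧ ∀ j, {j} ∈ I.feasible → j ≠ i →
      {i₂} ∈ I.feasible ∧ I.value j ≤ I.value i₂ := by
    rcases (Finset.univ.filter fun j => {j} ∈ I.feasible ∧ j ≠ i).eq_empty_or_nonempty with h | h
    · obtain ⟨i₂, hi₂⟩ : ∃ i₂, i₂ ≠ i := by
        have : Nontrivial (Fin n) := Fin.nontrivial_iff_two_le.2 hn
        exact exists_ne i
      refine ⟨i₂, hi₂, fun j hj hji => ?_⟩
      have : j ∈ (Finset.univ.filter fun j => {j} ∈ I.feasible ∧ j ≠ i) := by simp [hj, hji]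
      rw [h] at this
      simp at this
    · obtain ⟨i₂, hi₂, hm⟩ := Finset.exists_max_image _ I.value h
      have hi₂' : {i₂} ∈ I.feasible ∧ i₂ ≠ i := by simpa using hi₂
      exact ⟨i₂, hi₂'.2, fun j hj hji => ⟨hi₂'.1, hm j (by simp [hj, hji])⟩⟩
  set Q := Finset.univ.filter fun σ : Equiv.Perm (Fin n) =>
    n / 2 ≤ (σ.symm i : ℕ) ∧ (σ.symm i₂ : ℕ) < n / 2 with hQ
  have hcard : (n.factorial : ℝ) ≤ 4 * Q.card := by
    exact_mod_cast factorial_le_four_mul_card hne.symm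
  have hgain : ∀ σ ∈ Q, I.value i ≤ (threeRules n).gain I (0 : Fin 3) σ
      + (threeRules n).gain I (1 : Fin 3) σ := by
    intro σ hσ
    have hσ' : n / 2 ≤ (σ.symm i : ℕ) ∧ (σ.symm i₂ : ℕ) < n / 2 := by simpa [hQ] using hσ
    -- With `i` late and `i₂` early: in a tie the strict rule could never fire, but whatever the
    -- weak rule takes is as good as `i₂`, hence as `i`. Without a tie the strict rule can take
    -- nothing but `i`, whereas the weak one might take an item equal to `i₂`.
    by_cases htie : {i₂} ∈ I.feasible ∧ I.value i ≤ I.value i₂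
    · have := le_gain_weak I σ hi hmax hσ'.1 fun t ht _ =>
        htie.2.trans (by simpa using ht (σ.symm i₂) hσ'.2 (by simpa using htie.1))
      have := (threeRules n).gain_nonneg I (0 : Fin 3) σ
      linarith
    · have := le_gain_strict I σ hi hσ'.1 ?_ ?_
      · have := (threeRules n).gain_nonneg I (1 : Fin 3) σ
        linarith
      · intro j hj hjf
        have hji : σ j ≠ i := by
          rintro rfl
          rw [Equiv.symm_apply_apply] at hσ'
          omega
        obtain ⟨h3, h4⟩ := h₂ _ hjf hji
        push Not at htie
        exact h4.trans_lt (htie h3)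
      · intro t ht htf
        by_cases hti : σ t = i
        · rw [hti]
        · obtain ⟨h3, h4⟩ := h₂ _ htf hti
          have := ht (σ.symm i₂) hσ'.2 (by simpa using h3)
          rw [Equiv.apply_symm_apply] at this
          linarith
  have hsum : (Q.card : ℝ) * I.value i ≤ (∑ σ, (threeRules n).gain I (0 : Fin 3) σ)
      + ∑ σ, (threeRules n).gain I (1 : Fin 3) σ := by
    rw [← Finset.sum_add_distrib, ← nsmul_eq_mul, ← Finset.sum_const]
    refine (Finset.sum_le_sum hgain).trans ?_
    exact Finset.sum_le_sum_of_subset_of_nonneg (Finset.subset_univ _) fun σ _ _ =>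
      add_nonneg (gain_nonneg _ _ _ _) (gain_nonneg _ _ _ _)
  have := I.value_nonneg i
  nlinarith

end

/-! ### The threshold rule -/

namespace SecretaryInstance

variable {n : ℕ} (I : SecretaryInstance n) (σ : Equiv.Perm (Fin n))

open RandomizedSecretaryAlgorithm

open Classical in
/-- The feasible sets of items whose values are all at least `x`. -/
noncomputable def above (x : ℝ) : Finset (Finset (Fin n)) :=
  I.feasible.filter fun S => ∀ i ∈ S, x ≤ I.value i

theorem above_downwardClosed (x : ℝ) : ∀ S ∈ I.above x, ∀ T ⊆ S, T ∈ I.above x := by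
  intro S hS T hT
  simp only [above, Finset.mem_filter] at hS ⊢
  exact ⟨I.downwardClosed S hS.1 T hT, fun i hi => hS.2 i (hT hi)⟩

open Classical in
/-- The pairs consisting of the minimum value and the size of a feasible set of items that arrive
before time `h`, and the pair `(0, 0)`. -/
noncomputable def targets (h : ℕ) : Finset (ℝ × ℕ) :=
  insert (0, 0) (((Finset.univ ×ˢ I.feasible).filter fun p : Fin n × Finset (Fin n) =>
    p.1 ∈ p.2 ∧ ∀ j ∈ p.2, (σ.symm j : ℕ) < h ∧ I.value p.1 ≤ I.value j).image
      fun p => (I.value p.1, p.2.card))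

theorem mem_targets {h : ℕ} {p : ℝ × ℕ} : p ∈ I.targets σ h ↔ p = (0, 0) ∨
    ∃ a S, S ∈ I.feasible ∧ a ∈ S ∧ (∀ j ∈ S, (σ.symm j : ℕ) < h ∧ I.value a ≤ I.value j) ∧
      (I.value a, S.card) = p := by
  simp only [targets, Finset.mem_insert, Finset.mem_image, Finset.mem_filter, Finset.mem_product,
    Finset.mem_univ, true_and, Prod.exists]
  refine or_congr Iff.rfl (exists_congr fun a => exists_congr fun S => ?_)
  tauto

/-- After the sampling phase the extracted targets no longer depend on the time or on the selection,
so threshold and quota stay fixed along a run. -/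
theorem sampleTargets_view {h : ℕ} {t : Fin n} (ht : h ≤ (t : ℕ)) (W : Finset (Fin n)) :
    (I.view σ t W).sampleTargets h = I.targets σ h := by
  classical
  ext p
  rw [mem_targets]
  simp only [SecretaryView.sampleTargets, Finset.mem_insert, Finset.mem_image, Finset.mem_filter,
    Finset.mem_product, Finset.mem_univ, true_and, Prod.exists]
  refine or_congr Iff.rfl ?_
  constructor
  · rintro ⟨a, S, ⟨hS, ha, hj⟩, rfl⟩
    obtain ⟨hS1, hS2⟩ := SecretaryInstance.image_mem_of_mem_view_feasible.1 hS
    have hval : ∀ j ∈ S, (I.view σ t W).value j = I.value (σ j) := by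
      intro j hj
      simp [view, hS1 j hj]
    refine ⟨σ a, S.image σ, hS2, Finset.mem_image_of_mem _ ha, ?_, ?_⟩
    · intro i hi
      obtain ⟨j, hjS, rfl⟩ := Finset.mem_image.1 hi
      have := hj j hjS
      rw [hval j hjS, hval a ha] at this
      simpa using this
    · rw [hval a ha, Finset.card_image_of_injective _ σ.injective]
  · rintro ⟨a, S, hS, ha, hj, rfl⟩
    have hle : ∀ j ∈ S, σ.symm j ≤ t := fun j hjS => Fin.le_def.2 (by have := (hj j hjS).1; omega)
    refine ⟨σ.symm a, S.image σ.symm, ⟨?_, Finset.mem_image_of_mem _ ha, ?_⟩, ?_⟩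
    · rw [SecretaryInstance.image_mem_of_mem_view_feasible]
      refine ⟨fun j hj => ?_, by simpa [Finset.image_image] using hS⟩
      obtain ⟨i, hi, rfl⟩ := Finset.mem_image.1 hj
      exact hle i hi
    · intro i hi
      obtain ⟨j, hjS, rfl⟩ := Finset.mem_image.1 hi
      simpa [view, hle j hjS, hle a ha] using hj j hjS
    · simp [view, hle a ha, Finset.card_image_of_injective _ σ.symm.injective]

/-- The target value and size that the threshold rule extracts from the sample. -/
noncomputable def target : ℝ × ℕ := SecretaryView.bestTarget (I.targets σ (n / 2))

theorem target_mem : I.target σ ∈ I.targets σ (n / 2) :=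
  (SecretaryView.bestTarget_spec ⟨(0, 0), (I.mem_targets σ).2 (Or.inl rfl)⟩).1

theorem target_max {p : ℝ × ℕ} (hp : p ∈ I.targets σ (n / 2)) :
    (p.2 : ℝ) * p.1 ≤ (I.target σ).2 * (I.target σ).1 :=
  (SecretaryView.bestTarget_spec ⟨p, hp⟩).2 p hp

theorem target_size_le : (I.target σ).2 ≤ n := by
  rcases (I.mem_targets σ).1 (I.target_mem σ) with h | ⟨a, S, -, -, -, h⟩
  · simp [h]
  · rw [← h]
    simpa using Finset.card_le_univ S

theorem target_value_nonneg : 0 ≤ (I.target σ).1 := by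
  rcases (I.mem_targets σ).1 (I.target_mem σ) with h | ⟨a, S, -, -, -, h⟩
  · simp [h]
  · rw [← h]
    exact I.value_nonneg a

theorem target_value_le {M : ℝ} (hM : 0 ≤ M) (h : ∀ j, {j} ∈ I.feasible → I.value j ≤ M) :
    (I.target σ).1 ≤ M := by
  rcases (I.mem_targets σ).1 (I.target_mem σ) with h' | ⟨a, S, hS, ha, -, h'⟩
  · simpa [h'] using hM
  · rw [← h']
    exact h a (I.downwardClosed S hS _ (by simpa using ha))

theorem sum_sample_le {S : Finset (Fin n)} (hS : S ∈ I.feasible) :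
    ∑ i ∈ S.filter (fun i => (σ.symm i : ℕ) < n / 2), I.value i
      ≤ (I.target σ).2 * (I.target σ).1 * (harmonic I.rank : ℝ) := by
  have h0 : (0 : ℝ) ≤ (I.target σ).2 * (I.target σ).1 :=
    mul_nonneg (Nat.cast_nonneg _) (I.target_value_nonneg σ)
  refine (sum_le_mul_harmonic I.value _ _ ?_).trans (mul_le_mul_of_nonneg_left ?_ h0)
  · intro T hT a ha hmin
    refine I.target_max σ (p := (I.value a, T.card)) ((I.mem_targets σ).2 (Or.inr ?_))
    refine ⟨a, T, I.downwardClosed S hS T (hT.trans (Finset.filter_subset _ _)), ha, ?_, rfl⟩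
    exact fun j hj => ⟨(Finset.mem_filter.1 (hT hj)).2, hmin j hj⟩
  · refine Rat.cast_le.2 (harmonic_mono ((Finset.card_filter_le _ _).trans ?_))
    exact Finset.le_sup (f := Finset.card) hS

/-- The separate feasibility test is redundant here, since a rich position is itself a feasible set.
-/
theorem accept_threshold_iff {t : Fin n} {W : Finset (Fin n)} (hW : W ⊆ Finset.Iic t) :
    (threeRules n).accept (2 : Fin 3) (I.view σ t W) = true ↔
      n / 2 ≤ (t : ℕ) ∧ W.card < quota n (I.target σ).2 ∧
        Rich (I.above (I.target σ).1) ((I.target σ).2 - quota n (I.target σ).2)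
          (quota n (I.target σ).2 - W.card - 1) ((Finset.Iic t).image σ)
          (insert (σ t) (W.image σ)) := by
  classical
  have hins : insert t W ⊆ Finset.Iic t := Finset.insert_subset (by simp) hW
  refine (threeRules_accept_iff _ _).trans (and_congr_right fun ht => ?_)
  change n / 2 ≤ (t : ℕ) at ht
  have hrule : (I.view σ t W).Rule 2 ↔ W.card < quota n (I.target σ).2 ∧
      Rich ((I.view σ t W).above (I.target σ).1) ((I.target σ).2 - quota n (I.target σ).2)
        (quota n (I.target σ).2 - W.card - 1) (Finset.Iic t) (insert t W) := by
    simp only [SecretaryView.Rule]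
    rw [I.sampleTargets_view σ ht]
    exact Iff.rfl
  have himage : ∀ x : ℝ, ∀ S ⊆ Finset.Iic t,
      S ∈ (I.view σ t W).above x ↔ S.image σ ∈ I.above x := by
    intro x S hS
    have hS' : ∀ j ∈ S, j ≤ t := fun j hj => Finset.mem_Iic.1 (hS hj)
    simp only [SecretaryView.above, above, Finset.mem_filter,
      SecretaryInstance.image_mem_of_mem_view_feasible, Finset.forall_mem_image]
    refine and_congr (and_iff_right hS') (forall₂_congr fun j hj => ?_)
    simp [view, hS' j hj]
  rw [hrule, Rich.image_iff σ.injective (himage _) hins, Finset.image_insert]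
  refine and_iff_right_of_imp fun h => ?_
  have hmem := h.2.mem
  rw [← Finset.image_insert, ← himage _ _ hins] at hmem
  exact (Finset.mem_filter.1 hmem).1

/-- The set of times at which the threshold rule selects an item. -/
noncomputable def picked (k : ℕ) : Finset (Fin n) :=
  (threeRules n).selectedTimes I (2 : Fin 3) σ k

theorem picked_subset (t : Fin n) : I.picked σ t ⊆ Finset.Iic t := by
  intro j hj
  exact Finset.mem_Iic.2 (Fin.le_def.2 (((mem_selectedTimes _ _ _ _).1 hj).1.le))

theorem mem_picked {k : ℕ} {t : Fin n} : t ∈ I.picked σ k ↔ (t : ℕ) < k ∧ n / 2 ≤ (t : ℕ) ∧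
    (I.picked σ t).card < quota n (I.target σ).2 ∧
        Rich (I.above (I.target σ).1) ((I.target σ).2 - quota n (I.target σ).2)
          (quota n (I.target σ).2 - (I.picked σ t).card - 1) ((Finset.Iic t).image σ)
          (insert (σ t) ((I.picked σ t).image σ)) :=
  (mem_selectedTimes _ _ _ _).trans
    (and_congr_right fun _ => I.accept_threshold_iff σ (I.picked_subset σ t))

theorem picked_half : I.picked σ (n / 2) = ∅ := by
  refine Finset.eq_empty_of_forall_notMem fun t ht => ?_
  have := (I.mem_picked σ).1 ht
  omega

theorem picked_succ (t : Fin n) : I.picked σ (t + 1) = I.picked σ t ∨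
    (t ∈ I.picked σ (t + 1) ∧ I.picked σ (t + 1) = insert t (I.picked σ t)) := by
  have h : I.picked σ (t + 1) = _ := (threeRules n).selectedTimes_succ I (2 : Fin 3) σ t
  split_ifs at h with hacc
  · refine Or.inr ⟨?_, h⟩
    rw [h]
    exact Finset.mem_insert_self _ _
  · exact Or.inl h

theorem exists_of_quota_pos (h : 0 < quota n (I.target σ).2) :
    ∃ a S, (I.target σ).1 = I.value a ∧ S ∈ I.above (I.target σ).1 ∧
      S.card = (I.target σ).2 ∧ ∀ j ∈ S, (σ.symm j : ℕ) < n / 2 := by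
  rcases (I.mem_targets σ).1 (I.target_mem σ) with h' | ⟨a, S, hS, -, hj, h'⟩
  · rw [h'] at h
    simp [quota] at h
  · rw [← h']
    refine ⟨a, S, rfl, ?_, rfl, fun j hjS => (hj j hjS).1⟩
    simp only [above, Finset.mem_filter]
    exact ⟨hS, fun i hi => (hj i hi).2⟩

/-- From the end of the sampling phase on, the game for the remaining selections stays rich. -/
theorem rich_picked (h : 0 < quota n (I.target σ).2) {k : ℕ} (hk : n / 2 ≤ k) (hkn : k ≤ n) :
    Rich (I.above (I.target σ).1) ((I.target σ).2 - quota n (I.target σ).2)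
      (quota n (I.target σ).2 - (I.picked σ k).card)
      ((Finset.univ.filter fun t : Fin n => (t : ℕ) < k).image σ) ((I.picked σ k).image σ) := by
  induction k, hk using Nat.le_induction with
  | base =>
    obtain ⟨a, S, -, hS, hcard, hj⟩ := I.exists_of_quota_pos σ h
    have := quota_mul_seventeen_le n (I.target σ).2
    rw [picked_half, Finset.card_empty, Finset.image_empty, Nat.sub_zero]
    refine Rich.of_union_mem (I.above_downwardClosed _) (S := S) ?_ (by simp) (by simpa using hS)
      (by omega)
    intro j hjS
    exact Finset.mem_image.2 ⟨σ.symm j, by simpa using hj j hjS, by simp⟩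
  | succ k hk ih =>
    have hlt : k < n := by omega
    specialize ih (by omega)
    rcases I.picked_succ σ ⟨k, hlt⟩ with heq | ⟨hmem, heq⟩
    · change I.picked σ (k + 1) = I.picked σ k at heq
      rw [heq]
      refine ih.mono (Finset.image_subset_image ?_)
      intro t ht
      simp only [Finset.mem_filter, Finset.mem_univ, true_and] at ht ⊢
      omega
    · change I.picked σ (k + 1) = insert ⟨k, hlt⟩ (I.picked σ k) at heq
      have hr := ((I.mem_picked σ).1 hmem).2.2.2
      have hnot : (⟨k, hlt⟩ : Fin n) ∉ I.picked σ k := fun hc => by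
        have := ((I.mem_picked σ).1 hc).1
        simp at this
      rw [heq, Finset.card_insert_of_notMem hnot, Finset.image_insert, ← Nat.sub_sub]
      refine hr.mono (Finset.image_subset_image ?_)
      intro t ht
      simp only [Finset.mem_filter, Finset.mem_univ, true_and, Finset.mem_Iic, Fin.le_def] at ht ⊢
      omega

/-- A run that falls short makes `σ` stuck for its own set of selection times. That set, the
threshold and the size all depend on `σ`, which is why `badOrders` ranges over all of them; the
threshold is the value of some item `a`. -/
theorem quota_le_card_picked (hσ : σ ∉ badOrders fun a => I.above (I.value a)) :
    quota n (I.target σ).2 ≤ (I.picked σ n).card := by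
  classical
  by_contra hlt
  push Not at hlt
  have hpos : 0 < quota n (I.target σ).2 := by omega
  obtain ⟨a, -, ha, -⟩ := I.exists_of_quota_pos σ hpos
  refine hσ (mem_badOrders _ a (I.target_size_le σ) (I.picked σ n) hlt ?_)
  simp only [← ha, stuckOrders, Finset.mem_filter, Finset.mem_univ, true_and]
  rintro t ⟨ht, htP⟩
  have hfil : (I.picked σ n).filter (· < t) = I.picked σ t :=
    (threeRules n).filter_selectedTimes_lt I (2 : Fin 3) σ t
  rw [hfil]
  refine ⟨(I.rich_picked σ hpos ht t.isLt.le).mono (Finset.image_subset_image ?_), fun hr => ?_⟩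
  · intro j hj
    simp only [Finset.mem_filter, Finset.mem_univ, true_and] at hj
    exact Finset.mem_Iic.2 (Fin.le_def.2 hj.le)
  · refine htP ((I.mem_picked σ).2 ⟨t.isLt, ht, ?_, hr⟩)
    rw [← hfil]
    exact (Finset.card_filter_le _ _).trans_lt hlt

theorem card_picked_mul_le_gain :
    ((I.picked σ n).card : ℝ) * (I.target σ).1 ≤ (threeRules n).gain I (2 : Fin 3) σ := by
  refine le_of_le_of_eq ?_ (gain_eq (threeRules n) I (2 : Fin 3) σ).symm
  rw [← nsmul_eq_mul]
  refine Finset.card_nsmul_le_sum (I.picked σ n) (fun t => I.value (σ t)) _ fun t ht => ?_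
  have hmem := ((I.mem_picked σ).1 ht).2.2.2.mem
  exact (Finset.mem_filter.1 hmem).2 _ (Finset.mem_insert_self _ _)

open Classical in
theorem target_mul_le {M : ℝ} (hM : 0 ≤ M) (h : ∀ j, {j} ∈ I.feasible → I.value j ≤ M) :
    (I.target σ).2 * (I.target σ).1 ≤ 17 * ((Nat.log 2 n + 1 : ℕ) : ℝ) * M +
      34 * ((Nat.log 2 n + 1 : ℕ) : ℝ) * (threeRules n).gain I (2 : Fin 3) σ +
      if σ ∈ badOrders fun a => I.above (I.value a) then n * M else 0 := by
  have hv := I.target_value_le σ hM h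
  have hv0 := I.target_value_nonneg σ
  have hg0 := (threeRules n).gain_nonneg I (2 : Fin 3) σ
  set L := Nat.log 2 n + 1 with hL
  have hL0 : (0 : ℝ) ≤ L := Nat.cast_nonneg L
  have hLM : 0 ≤ 17 * (L : ℝ) * M := by positivity
  have hLg : 0 ≤ 34 * (L : ℝ) * (threeRules n).gain I (2 : Fin 3) σ := by positivity
  -- On a bad order only the trivial bounds on size and threshold are used. Otherwise the quota is
  -- met, and the rounding in `quota` costs one extra item of value at most `M`.
  split_ifs with hσ
  · have h1 : ((I.target σ).2 : ℝ) * (I.target σ).1 ≤ n * M := by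
      have : ((I.target σ).2 : ℝ) ≤ n := by exact_mod_cast I.target_size_le σ
      gcongr
    linarith
  · have hq := I.quota_le_card_picked σ hσ
    have hg := I.card_picked_mul_le_gain σ
    have hlt := lt_quota_add_one_mul n (I.target σ).2
    set k := (I.target σ).2
    set m := quota n k
    set v := (I.target σ).1
    have hlt' : (k : ℝ) ≤ (m + 1) * (17 * L) := by exact_mod_cast hlt.le
    have h1 : (m : ℝ) * v ≤ (threeRules n).gain I (2 : Fin 3) σ := by
      have : (m : ℝ) ≤ (I.picked σ n).card := by exact_mod_cast hq
      exact (mul_le_mul_of_nonneg_right this hv0).trans hg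
    calc (k : ℝ) * v ≤ (m + 1) * (17 * L) * v := by gcongr
      _ = 17 * L * v + 17 * L * (m * v) := by ring
      _ ≤ 17 * L * M + 17 * L * (threeRules n).gain I (2 : Fin 3) σ := by gcongr
      _ ≤ _ := by linarith

/-! ### Averaging over the arrival order and conclusion -/

theorem sum_target_mul_le (hn : 2 ≤ n) {i : Fin n} (hi : {i} ∈ I.feasible)
    (hmax : ∀ j, {j} ∈ I.feasible → I.value j ≤ I.value i) :
    ∑ σ, ((I.target σ).2 : ℝ) * (I.target σ).1 ≤
      216 * ((Nat.log 2 n + 1 : ℕ) : ℝ) * ((n.factorial : ℝ) * (threeRules n).expectedValue I) := by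
  classical
  have h1 := Finset.sum_le_sum fun σ (_ : σ ∈ Finset.univ) =>
    I.target_mul_le σ (I.value_nonneg i) hmax
  simp only [Finset.sum_add_distrib, ← Finset.mul_sum, ← Finset.sum_filter, Finset.sum_const,
    nsmul_eq_mul, Finset.card_univ, Fintype.card_perm, Fintype.card_fin,
    Finset.filter_univ_mem] at h1
  have h2 := card_badOrders_mul_le hn fun a => I.above (I.value a)
  have h3 := value_mul_factorial_le I hn hi hmax
  have h4 := threeRules_expectedValue I
  have h5 : 0 ≤ ∑ σ, (threeRules n).gain I (2 : Fin 3) σ :=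
    Finset.sum_nonneg fun σ _ => (threeRules n).gain_nonneg I (2 : Fin 3) σ
  set g2 := ∑ σ, (threeRules n).gain I (2 : Fin 3) σ
  set g01 := (∑ σ, (threeRules n).gain I (0 : Fin 3) σ)
    + ∑ σ, (threeRules n).gain I (1 : Fin 3) σ
  set L := Nat.log 2 n + 1 with hL
  set M := I.value i
  have hM : 0 ≤ M := I.value_nonneg i
  have hL1 : (1 : ℝ) ≤ L := by exact_mod_cast (by omega : 1 ≤ L)
  have h6 : n * (((badOrders fun a => I.above (I.value a)).card : ℝ) * M) ≤ n.factorial * M := by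
    calc _ = (n * ((badOrders fun a => I.above (I.value a)).card : ℝ)) * M := by ring
      _ ≤ _ := by gcongr
  calc _ ≤ _ := h1
    -- The bad orders contribute at most `M` on average, absorbed as an 18th copy of `L * M`.
    _ ≤ 17 * (L : ℝ) * (n.factorial * M) + 34 * (L : ℝ) * g2 + L * (n.factorial * M) := by
        refine add_le_add le_rfl (h6.trans (le_mul_of_one_le_left (by positivity) hL1))
    _ = 18 * L * (M * n.factorial) + 34 * L * g2 := by ring
    _ ≤ 18 * L * (4 * g01) + 72 * L * g2 := by gcongr; norm_num
    _ = 72 * L * (g01 + g2) := by ring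
    _ = _ := by rw [← h4]; ring

/-- Each item is sampled with probability at least `1 / 3`, the worst case being `n = 3`, so the
sampled part of `S` keeps a third of its value on average. -/
theorem sum_mul_factorial_le (hn : 2 ≤ n) {S : Finset (Fin n)} (hS : S ∈ I.feasible) :
    (∑ i ∈ S, I.value i) * (n.factorial : ℝ) ≤
      3 * ((∑ σ, ((I.target σ).2 : ℝ) * (I.target σ).1) * (harmonic I.rank : ℝ)) := by
  classical
  have hcount : ∀ i : Fin n, (n.factorial : ℝ) ≤
      3 * (Finset.univ.filter fun σ : Equiv.Perm (Fin n) => (σ.symm i : ℕ) < n / 2).card := by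
    intro i
    have h := card_perm_symm_apply_mem i (Finset.univ.filter fun t : Fin n => (t : ℕ) < n / 2)
    rw [card_fin_lt (Nat.div_le_self _ _)] at h
    simp only [Finset.mem_filter, Finset.mem_univ, true_and] at h
    have h3 : n ≤ 3 * (n / 2) := by omega
    have : n.factorial ≤
        3 * (Finset.univ.filter fun σ : Equiv.Perm (Fin n) => (σ.symm i : ℕ) < n / 2).card := by
      refine Nat.le_of_mul_le_mul_left ?_ (by omega : 0 < n)
      calc n * n.factorial ≤ 3 * (n / 2) * n.factorial := by gcongr
        _ = 3 * (n / 2 * n.factorial) := by ring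
        _ = _ := by rw [← h]; ring
    exact_mod_cast this
  have hle := Finset.sum_le_sum fun σ (_ : σ ∈ Finset.univ) => I.sum_sample_le σ hS
  rw [← Finset.sum_mul] at hle
  refine le_trans ?_ (mul_le_mul_of_nonneg_left hle (by norm_num))
  simp only [Finset.sum_filter]
  rw [Finset.sum_comm, Finset.sum_mul, Finset.mul_sum]
  refine Finset.sum_le_sum fun i _ => ?_
  rw [← Finset.sum_filter, Finset.sum_const, nsmul_eq_mul]
  have := mul_le_mul_of_nonneg_left (hcount i) (I.value_nonneg i)
  linarith

theorem opt_le_of_two_le (hn : 2 ≤ n) {i : Fin n} (hi : {i} ∈ I.feasible)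
    (hmax : ∀ j, {j} ∈ I.feasible → I.value j ≤ I.value i) :
    I.opt ≤ 648 * ((Nat.log 2 n + 1 : ℕ) : ℝ) * (harmonic I.rank : ℝ) *
      (threeRules n).expectedValue I := by
  obtain ⟨S, hS, hopt⟩ := Finset.exists_mem_eq_sup' I.nonempty (fun S => ∑ i ∈ S, I.value i)
  have h1 := I.sum_mul_factorial_le hn hS
  have h2 := I.sum_target_mul_le hn hi hmax
  have hH : (0 : ℝ) ≤ (harmonic I.rank : ℝ) := by
    exact_mod_cast (harmonic_mono (Nat.zero_le I.rank))
  have hf : (0 : ℝ) < n.factorial := by positivity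
  rw [opt, hopt]
  refine le_of_mul_le_mul_right ?_ hf
  calc _ ≤ _ := h1
    _ ≤ 3 * (216 * ((Nat.log 2 n + 1 : ℕ) : ℝ) *
        ((n.factorial : ℝ) * (threeRules n).expectedValue I) * (harmonic I.rank : ℝ)) := by gcongr
    _ = _ := by ring

/-- The sample is empty, so the weak secretary rule takes the only item. -/
theorem opt_le_of_lt_two (hn : n < 2) {i : Fin n} (hi : {i} ∈ I.feasible) :
    I.opt ≤ 3 * (threeRules n).expectedValue I := by
  have hall : ∀ j : Fin n, j = i := fun j => Fin.ext (by omega)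
  have hopt : I.opt ≤ I.value i := by
    refine Finset.sup'_le _ _ fun S _ => ?_
    calc ∑ j ∈ S, I.value j ≤ ∑ j ∈ {i}, I.value j :=
        Finset.sum_le_sum_of_subset_of_nonneg (fun j _ => by simp [hall j])
          fun j _ _ => I.value_nonneg j
      _ = I.value i := by simp
  have hgain : ∀ σ : Equiv.Perm (Fin n), I.value i ≤ (threeRules n).gain I (1 : Fin 3) σ :=
    fun σ => le_gain_weak I σ hi (fun j _ => by rw [hall j]) (by omega)
      fun t _ _ => by rw [hall (σ t)]
  have hsum := Finset.sum_le_sum fun σ (_ : σ ∈ Finset.univ) => hgain σ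
  rw [Finset.sum_const, nsmul_eq_mul, Finset.card_univ, Fintype.card_perm, Fintype.card_fin] at hsum
  have h0 : 0 ≤ ∑ σ, (threeRules n).gain I (0 : Fin 3) σ :=
    Finset.sum_nonneg fun σ _ => (threeRules n).gain_nonneg I (0 : Fin 3) σ
  have h2 : 0 ≤ ∑ σ, (threeRules n).gain I (2 : Fin 3) σ :=
    Finset.sum_nonneg fun σ _ => (threeRules n).gain_nonneg I (2 : Fin 3) σ
  have h := threeRules_expectedValue I
  have hf : (0 : ℝ) < n.factorial := by positivity
  refine hopt.trans (le_of_mul_le_mul_left ?_ hf)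
  linarith

theorem expectedValue_nonneg : 0 ≤ (threeRules n).expectedValue I := by
  refine Finset.sum_nonneg fun s _ => mul_nonneg ((threeRules n).prob_nonneg s)
    (div_nonneg (Finset.sum_nonneg fun σ _ => ?_) (by positivity))
  exact (threeRules n).gain_nonneg I s σ

theorem opt_le_mul_expectedValue :
    I.opt ≤ 2592 * (max 1 (Real.logb 2 (n : ℝ)) * max 1 (Real.logb 2 (I.rank : ℝ))) *
      (threeRules n).expectedValue I := by
  have hE := I.expectedValue_nonneg
  have hN : (1 : ℝ) ≤ max 1 (Real.logb 2 (n : ℝ)) := le_max_left _ _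
  have hR : (1 : ℝ) ≤ max 1 (Real.logb 2 (I.rank : ℝ)) := le_max_left _ _
  have hNR := one_le_mul_of_one_le_of_one_le hN hR
  by_cases hex : ∃ i, {i} ∈ I.feasible
  · classical
    obtain ⟨i₀, hi₀⟩ := hex
    obtain ⟨i, hi, hmax⟩ := Finset.exists_max_image
      (Finset.univ.filter fun i => {i} ∈ I.feasible) I.value ⟨i₀, by simpa using hi₀⟩
    replace hi : {i} ∈ I.feasible := by simpa using hi
    rcases lt_or_ge n 2 with hn | hn
    · exact (I.opt_le_of_lt_two hn hi).trans (mul_le_mul_of_nonneg_right (by linarith) hE)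
    · refine (I.opt_le_of_two_le hn hi fun j hj => hmax j (by simpa using hj)).trans ?_
      have h1 := natLog_add_one_le n
      have h2 := harmonic_le_two_mul_max_logb I.rank
      have hH : (0 : ℝ) ≤ (harmonic I.rank : ℝ) := by
        exact_mod_cast (harmonic_mono (Nat.zero_le I.rank))
      refine mul_le_mul_of_nonneg_right ?_ hE
      calc 648 * ((Nat.log 2 n + 1 : ℕ) : ℝ) * (harmonic I.rank : ℝ)
          ≤ 648 * (2 * max 1 (Real.logb 2 (n : ℝ))) * (2 * max 1 (Real.logb 2 (I.rank : ℝ))) := by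
            gcongr
        _ = _ := by ring
  · push Not at hex
    have hopt : I.opt ≤ 0 := by
      refine Finset.sup'_le _ _ fun S hS => ?_
      rcases S.eq_empty_or_nonempty with rfl | ⟨i, hi⟩
      · simp
      · exact absurd (I.downwardClosed S hS {i} (by simpa using hi)) (hex i)
    refine hopt.trans (mul_nonneg ?_ hE)
    linarith

end SecretaryInstance

theorem mainTheorem4 :
    ∃ C : ℝ, 0 < C ∧ ∃ A : (n : ℕ) → RandomizedSecretaryAlgorithm n, ∀ n : ℕ,
      (A n).AchievesCompetitiveRatio (fun I =>
        C * (max 1 (Real.logb 2 (n : ℝ)) * max 1 (Real.logb 2 (I.rank : ℝ)))) := by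
  -- `2592 = 648 * 2 * 2`: the two factors 2 pass from `Nat.log 2 n + 1` and the harmonic number to
  -- the maxima, and `648 = 72 * 3 * 3` comes from the threshold analysis, the choice among three
  -- rules and the sampling probability.
  refine ⟨2592, by norm_num, threeRules, fun n => ⟨threeRules_maintainsFeasibility n, fun I => ?_⟩⟩
  have hN : (1 : ℝ) ≤ max 1 (Real.logb 2 (n : ℝ)) := le_max_left _ _
  have hR : (1 : ℝ) ≤ max 1 (Real.logb 2 (I.rank : ℝ)) := le_max_left _ _
  rw [div_le_iff₀ (by positivity), mul_comm]
  exact I.opt_le_mul_expectedValue
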